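/- Let $F$ be a field of characteristic different from two. By a form over $F$ we mean a non-degenerate quadratic form of positive (finite) dimension over $F$; a form is anisotropic if it does not represent zero non-trivially, and hyperbolic if it is isometric to an orthogonal sum of copies of the hyperbolic plane $\langle 1,-1\rangle$. For a form $p$ over $F$ of dimension $m\geq 2$ that is not isometric to $\langle 1,-1\rangle$, the function field $F(p)$ is the field of fractions of the integral domain $F[X_1,\ldots,X_m]/(p(X_1,\ldots,X_m))$; if $\dim p=1$ or $p\simeq\langle 1,-1\rangle$, we set $F(p)=F$. For an integer $n\geq 1$, an $n$-fold Pfister form over $F$ is a form isometric to $\langle 1,a_1\rangle\otimes\cdots\otimes\langle 1,a_n\rangle$ for some $a_1,\ldots,a_n\in F^{\times}$. Proposition. Let $q$ be an anisotropic form over $F$. Then there exists a form $p$ over $F$ such that $q$ becomes hyperbolic after scalar extension to $F(p)$ if and only if $q\simeq \pi\otimes r$ for some $n\geq 1$, some $n$-fold Pfister form $\pi$ over $F$ and some form $r$ over $F$. -/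

import Mathlib

open scoped TensorProduct

universe u v

namespace QuadForm

/-- A *form*: a non-degenerate quadratic form of positive (finite) dimension. -/
structure IsForm {F : Type u} [Field F] {V : Type v} [AddCommGroup V] [Module F V]
    (q : QuadraticForm F V) : Prop where
  finite : FiniteDimensional F V
  pos : 0 < Module.finrank F V
  nondegenerate : q.Nondegenerate

/-- The diagonal form `⟨a₁, …, aₙ⟩`. -/
def diag {F : Type u} [Field F] {n : ℕ} (a : Fin n → F) : QuadraticForm F (Fin n → F) :=
  QuadraticMap.weightedSumSquares F a

/-- The hyperbolic plane `⟨1, -1⟩`. -/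
def hyperbolicPlane (F : Type u) [Field F] : QuadraticForm F (Fin 2 → F) :=
  diag ![1, -1]

/-- `q` is hyperbolic: `q` is isometric to the orthogonal sum of some number of copies
of `⟨1, -1⟩`. -/
def IsHyperbolic {F : Type u} [Field F] {V : Type v} [AddCommGroup V] [Module F V]
    (q : QuadraticForm F V) : Prop :=
  ∃ i : ℕ, q.Equivalent (QuadraticMap.pi fun _ : Fin i => hyperbolicPlane F)

/-- `π` is an `n`-fold Pfister form, i.e. `π ≃ ⟨1, a₁⟩ ⊗ ⋯ ⊗ ⟨1, aₙ⟩` for some nonzero `aᵢ`;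
`⟨1⟩` is the `0`-fold Pfister form. -/
def IsPfister {F : Type u} [Field F] [Invertible (2 : F)] :
    ℕ → ∀ {V : Type u} [AddCommGroup V] [Module F V], QuadraticForm F V → Prop
  | 0, _, _, _, π => π.Equivalent (diag ![(1 : F)])
  | n + 1, _, _, _, π =>
      ∃ (a : Fˣ) (W : Type u) (_ : AddCommGroup W) (_ : Module F W) (σ : QuadraticForm F W),
        IsPfister n σ ∧ π.Equivalent (QuadraticForm.tmul (diag ![(1 : F), (a : F)]) σ)

/-- The homogeneous quadratic polynomial `p(X₁, …, Xₘ)`. -/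
noncomputable def poly {F : Type u} [Field F] [Invertible (2 : F)] {m : ℕ}
    (p : QuadraticForm F (Fin m → F)) : MvPolynomial (Fin m) F :=
  ∑ i, ∑ j, MvPolynomial.C (p.toMatrix' i j) * MvPolynomial.X i * MvPolynomial.X j

theorem eval_poly {F : Type u} [Field F] [Invertible (2 : F)] {m : ℕ}
    (p : QuadraticForm F (Fin m → F)) (x : Fin m → F) :
    MvPolynomial.eval x (poly p) = p x := by
  have h : p x = p.associated x x := (QuadraticMap.associated_eq_self_apply F p x).symm
  rw [h, ← Matrix.toLinearMap₂'_toMatrix' (R := F) p.associated,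
    Matrix.toLinearMap₂'_apply]
  simp only [poly, map_sum, map_mul, MvPolynomial.eval_C, MvPolynomial.eval_X,
    QuadraticForm.toMatrix', smul_eq_mul]
  exact Finset.sum_congr rfl fun i _ => Finset.sum_congr rfl fun j _ => by ring

theorem poly_isHomogeneous {F : Type u} [Field F] [Invertible (2 : F)] {m : ℕ}
    (p : QuadraticForm F (Fin m → F)) : (poly p).IsHomogeneous 2 := by
  refine MvPolynomial.IsHomogeneous.sum _ _ _ fun i _ =>
    MvPolynomial.IsHomogeneous.sum _ _ _ fun j _ => ?_
  exact (MvPolynomial.isHomogeneous_C_mul_X _ _).mul (MvPolynomial.isHomogeneous_X _ _)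

theorem exists_linear {F : Type u} [Field F] {m : ℕ} (A : MvPolynomial (Fin m) F)
    (hA : A.IsHomogeneous 1) :
    ∃ l : (Fin m → F) →ₗ[F] F, ∀ x, MvPolynomial.eval x A = l x := by
  have h : A ∈ MvPolynomial.homogeneousSubmodule (Fin m) F 1 := hA
  rw [MvPolynomial.homogeneousSubmodule_one_eq_span_X] at h
  induction h using Submodule.span_induction with
  | mem x hx =>
    obtain ⟨i, rfl⟩ := hx
    exact ⟨LinearMap.proj i, fun x => by simp⟩
  | zero => exact ⟨0, fun x => by simp⟩
  | add x y hx hy h1 h2 =>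
    have e : (MvPolynomial.homogeneousSubmodule (Fin m) F 1) =
      Submodule.span F (Set.range MvPolynomial.X) :=
        MvPolynomial.homogeneousSubmodule_one_eq_span_X ..
    rw [← e] at hx hy
    obtain ⟨l, hl⟩ := h1 hx
    obtain ⟨k, hk⟩ := h2 hy
    exact ⟨l + k, fun x => by simp [hl, hk]⟩
  | smul a x hx h1 =>
    have e : (MvPolynomial.homogeneousSubmodule (Fin m) F 1) =
      Submodule.span F (Set.range MvPolynomial.X) :=
        MvPolynomial.homogeneousSubmodule_one_eq_span_X ..
    rw [← e] at hx
    obtain ⟨l, hl⟩ := h1 hx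
    exact ⟨a • l, fun x => by simp [hl, MvPolynomial.smul_eval]⟩

/-- A form that factors as a product of two linear forms has dimension one or is the
hyperbolic plane. -/
theorem exceptional_of_eq_mul {F : Type u} [Field F] [Invertible (2 : F)] {m : ℕ}
    (p : QuadraticForm F (Fin m → F)) (hp : IsForm p) (a b : (Fin m → F) →ₗ[F] F)
    (hab : ∀ x, p x = a x * b x) : m = 1 ∨ p.Equivalent (hyperbolicPlane F) := by
  have hm : 0 < m := by simpa using hp.pos
  have h2 : (⅟2 : F) * 2 = 1 := invOf_mul_self 2
  let f : (Fin m → F) →ₗ[F] (Fin 2 → F) :=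
    LinearMap.pi ![(⅟2 : F) • (a + b), (⅟2 : F) • (a - b)]
  have f0 : ∀ x, f x 0 = ⅟2 * (a x + b x) := fun x => by simp [f, mul_add]
  have f1 : ∀ x, f x 1 = ⅟2 * (a x - b x) := fun x => by simp [f, mul_sub]
  have hinj : Function.Injective f := by
    rw [← LinearMap.ker_eq_bot, eq_bot_iff]
    intro x hx
    have hx' : f x = 0 := hx
    have e0 : ⅟2 * (a x + b x) = 0 := by rw [← f0, hx']; rfl
    have e1 : ⅟2 * (a x - b x) = 0 := by rw [← f1, hx']; rfl
    have ha : a x = 0 := by linear_combination e0 + e1 - a x * h2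
    have hb : b x = 0 := by linear_combination e0 - e1 - b x * h2
    rw [← hp.nondegenerate.radical_eq_bot, QuadraticMap.mem_radical_iff']
    simp [hab, ha, hb]
  have hle : m ≤ 2 := by
    simpa using LinearMap.finrank_le_finrank_of_injective hinj
  rcases (by omega : m = 1 ∨ m = 2) with h | h
  · exact Or.inl h
  · subst h
    refine Or.inr ⟨⟨LinearEquiv.ofInjectiveEndo f hinj, fun x => ?_⟩⟩
    have : (hyperbolicPlane F) (f x) = p x := by
      simp only [hyperbolicPlane, diag, QuadraticMap.weightedSumSquares_apply, Fin.sum_univ_two,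
        f0, f1, hab]
      simp only [Matrix.cons_val_zero, Matrix.cons_val_one, smul_eq_mul]
      linear_combination (a x * b x) * (⅟2 * 2 + 1) * h2
    exact this

theorem poly_irreducible {F : Type u} [Field F] [Invertible (2 : F)] {m : ℕ}
    (p : QuadraticForm F (Fin m → F)) (hp : IsForm p)
    (h : ¬ (m = 1 ∨ p.Equivalent (hyperbolicPlane F))) : Irreducible (poly p) := by
  have hne : poly p ≠ 0 := fun h0 => h <| exceptional_of_eq_mul p hp 0 0 fun x => by
    rw [← eval_poly, h0]; simp
  have hdeg : (poly p).totalDegree = 2 := (poly_isHomogeneous p).totalDegree hne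
  have hu : ∀ A : MvPolynomial (Fin m) F, A ≠ 0 → A.totalDegree = 0 → IsUnit A := by
    intro A hA h0
    rw [MvPolynomial.totalDegree_eq_zero_iff_eq_C.mp h0] at hA ⊢
    refine IsUnit.map MvPolynomial.C (isUnit_iff_ne_zero.mpr fun hc => hA ?_)
    rw [hc, map_zero]
  refine ⟨fun hunit => ?_, fun A B hAB => ?_⟩
  · have := (MvPolynomial.isUnit_iff_totalDegree_of_isReduced.mp hunit).2
    omega
  · by_contra! hcon
    have hA : A ≠ 0 := fun h0 => hne (by rw [hAB, h0, zero_mul])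
    have hB : B ≠ 0 := fun h0 => hne (by rw [hAB, h0, mul_zero])
    have hs := MvPolynomial.totalDegree_mul_of_isDomain hA hB
    rw [← hAB, hdeg] at hs
    have hA0 : A.totalDegree ≠ 0 := fun h0 => hcon.1 (hu A hA h0)
    have hB0 : B.totalDegree ≠ 0 := fun h0 => hcon.2 (hu B hB h0)
    have dec : ∀ C : MvPolynomial (Fin m) F, C.totalDegree = 1 →
        C = MvPolynomial.C (MvPolynomial.coeff 0 C) + MvPolynomial.homogeneousComponent 1 C := by
      intro C hC
      conv_lhs => rw [← MvPolynomial.sum_homogeneousComponent C, hC]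
      simp [Finset.sum_range_succ]
    have eA := dec A (by omega)
    have eB := dec B (by omega)
    have hA1 := MvPolynomial.homogeneousComponent_isHomogeneous 1 A
    have hB1 := MvPolynomial.homogeneousComponent_isHomogeneous 1 B
    set A1 := MvPolynomial.homogeneousComponent 1 A
    set B1 := MvPolynomial.homogeneousComponent 1 B
    obtain ⟨a, ha⟩ := exists_linear A1 hA1
    obtain ⟨b, hb⟩ := exists_linear B1 hB1
    refine h (exceptional_of_eq_mul p hp a b fun x => ?_)
    rw [← eval_poly, ← ha, ← hb, ← map_mul]
    congr 1
    have e2 : MvPolynomial.homogeneousComponent 2 (poly p) = poly p :=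
      MvPolynomial.homogeneousComponent_eq_self (poly_isHomogeneous p)
    have z1 : MvPolynomial.homogeneousComponent 2 A1 = 0 := by
      rw [MvPolynomial.homogeneousComponent_of_mem hA1]; simp
    have z2 : MvPolynomial.homogeneousComponent 2 B1 = 0 := by
      rw [MvPolynomial.homogeneousComponent_of_mem hB1]; simp
    have z3 : MvPolynomial.homogeneousComponent 2 (A1 * B1) = A1 * B1 :=
      MvPolynomial.homogeneousComponent_eq_self (hA1.mul hB1)
    have z0 : ∀ c : F, MvPolynomial.homogeneousComponent 2
        (MvPolynomial.C c : MvPolynomial (Fin m) F) = 0 := fun c => by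
      rw [MvPolynomial.homogeneousComponent_of_mem (MvPolynomial.isHomogeneous_C _ c)]; simp
    have e3 : A * B = MvPolynomial.C (MvPolynomial.coeff 0 A * MvPolynomial.coeff 0 B)
        + MvPolynomial.C (MvPolynomial.coeff 0 A) * B1
        + MvPolynomial.C (MvPolynomial.coeff 0 B) * A1 + A1 * B1 := by
      conv_lhs => rw [eA, eB]
      rw [MvPolynomial.C_mul]
      ring
    rw [← e2, hAB, e3]
    simp only [map_add, MvPolynomial.homogeneousComponent_C_mul, z0, z1, z2, z3, mul_zero,
      add_zero, zero_add]

/-- A field extension of `F`. -/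
structure Extension (F : Type u) [Field F] where
  carrier : Type u
  [field : Field carrier]
  [algebra : Algebra F carrier]

attribute [instance] Extension.field Extension.algebra

/-- The coordinate ring `F[X₁, …, Xₘ] / (p(X₁, …, Xₘ))` of the affine quadric `p(X) = 0`. -/
abbrev CoordRing {F : Type u} [Field F] [Invertible (2 : F)] {m : ℕ}
    (p : QuadraticForm F (Fin m → F)) : Type u :=
  MvPolynomial (Fin m) F ⧸ Ideal.span {poly p}

theorem coordRing_isDomain {F : Type u} [Field F] [Invertible (2 : F)] {m : ℕ}
    (p : QuadraticForm F (Fin m → F)) (hp : IsForm p)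
    (h : ¬ (m = 1 ∨ p.Equivalent (hyperbolicPlane F))) : IsDomain (CoordRing p) := by
  have hirr := poly_irreducible p hp h
  have : (Ideal.span {poly p}).IsPrime :=
    (Ideal.span_singleton_prime hirr.ne_zero).mpr hirr.prime
  exact Ideal.Quotient.isDomain _

open Classical in
/-- The function field `F(p)`: the quotient field of `F[X₁, …, Xₘ] / (p(X₁, …, Xₘ))`, except
that `F(p) = F` if `dim p = 1` or `p ≃ ⟨1, -1⟩`. -/
noncomputable def functionField {F : Type u} [Field F] [Invertible (2 : F)] {m : ℕ}
    (p : QuadraticForm F (Fin m → F)) (hp : IsForm p) : Extension F :=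
  if h : m = 1 ∨ p.Equivalent (hyperbolicPlane F) then
    { carrier := F }
  else
    haveI : IsDomain (CoordRing p) := coordRing_isDomain p hp h
    { carrier := FractionRing (CoordRing p) }

/-- `q` is hyperbolic over `K`: the form `q_K` obtained by scalar extension is hyperbolic. -/
def IsHyperbolicOver {F : Type u} [Field F] [Invertible (2 : F)] {V : Type v} [AddCommGroup V]
    [Module F V] (q : QuadraticForm F V) (K : Extension F) : Prop :=
  IsHyperbolic (q.baseChange K.carrier)

end QuadForm

/-! Both conditions are equivalent to a third: for some `d ≠ 0` there is a linear map `J` with `J² =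
d` that is skew for the bilinear form of `q` (`IsSkewRoot`).

Such a `J` makes `B(x, J y)` alternating. By anisotropy, a subspace `W` maximal with `B(W, J W) = 0`
satisfies `V = W ⊥ J W`, and an orthogonal basis of `W` gives `q ≃ ⟨1, -d⟩ ⊗ r`
(`IsSkewRoot.equivalent_tmul`). Conversely, multiplication by `√-a` on `⟨1, a⟩`, the norm form of
`F(√-a)`, is a skew root of `-a`; it extends to every multiple of `⟨1, a⟩`. Since `-a` is a square
in the function field of `⟨1, a⟩`, every anisotropic multiple is hyperbolic there. So a single
binary factor decides everything, and `n = 1` suffices.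

It remains to get `J` from hyperbolicity over `F(p)`. If `p` is anisotropic of dimension at least
two, it acquires a zero over a quadratic extension `K = F(√δ)`. The points of `p = 0` over `K(X)`
are dense enough to specialize a Lagrangian (a totally isotropic subspace of half the dimension)
from `F(p)` to `K(X)`, and then to `K` by setting `X = 0`. A Lagrangian in `K ^ n` is the graph of
an `F`-linear map from imaginary to real parts, and that map is `J`. If `p` is isotropic and `F(p) ≠
F`, the same specialization with `K = F` contradicts anisotropy of `q`. -/

namespace QuadForm

/-! ### Forms compared through Gram matrices -/

section Basis

variable {F : Type*} [Field F] [Invertible (2 : F)] {V : Type*} [AddCommGroup V] [Module F V]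
  {W : Type*} [AddCommGroup W] [Module F W]

theorem equivalent_of_basis {ι : Type*} {Q : QuadraticForm F V} {Q' : QuadraticForm F W}
    (b : Module.Basis ι F V) (b' : Module.Basis ι F W)
    (h : ∀ i j, Q.associated (b i) (b j) = Q'.associated (b' i) (b' j)) : Q.Equivalent Q' := by
  have key : Q.associated =
      (Q'.associated).compl₁₂ (b.equiv b' (Equiv.refl ι)).toLinearMap
        (b.equiv b' (Equiv.refl ι)).toLinearMap := by
    refine b.ext fun i => b.ext fun j => ?_
    simpa using h i j
  refine ⟨⟨b.equiv b' (Equiv.refl ι), fun x => ?_⟩⟩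
  have := LinearMap.congr_fun (LinearMap.congr_fun key x) x
  simp only [LinearMap.compl₁₂_apply, QuadraticMap.associated_eq_self_apply] at this
  exact this.symm

theorem associated_diag {n : ℕ} (a x y : Fin n → F) :
    (diag a).associated x y = ∑ i, a i * x i * y i := by
  have h := LinearMap.congr_fun₂ (QuadraticMap.two_nsmul_associated F (diag a)) x y
  refine mul_left_cancel₀ (Invertible.ne_zero (2 : F)) ?_
  simp only [LinearMap.smul_apply, nsmul_eq_mul, Nat.cast_ofNat] at h
  refine h.trans ?_
  simp only [QuadraticMap.polarBilin_apply_apply, QuadraticMap.polar, diag,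
    QuadraticMap.weightedSumSquares_apply, Pi.add_apply, smul_eq_mul, ← Finset.sum_sub_distrib,
    Finset.mul_sum]
  exact Finset.sum_congr rfl fun i _ => by ring

theorem isForm_diag {n : ℕ} (hn : 0 < n) (a : Fin n → F) (ha : ∀ i, a i ≠ 0) :
    IsForm (diag a) := by
  refine ⟨inferInstance, by simpa using hn, ?_⟩
  rw [QuadraticMap.nondegenerate_iff_radical_eq_bot, QuadraticMap.radical_eq_ker_associated,
    eq_bot_iff]
  intro x hx
  ext i
  have := LinearMap.congr_fun (LinearMap.mem_ker.1 hx) (Pi.single i 1)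
  rw [associated_diag] at this
  simpa [Pi.single_apply, ha i] using this

/-- A family of vectors of the right cardinality that is orthogonal with no isotropic member
spans a hyperbolic form if its values are `1, -1, …, 1, -1`. -/
theorem isHyperbolic_of_family {Q : QuadraticForm F V} {l : ℕ} (h0 : 0 < l)
    (hl : Module.finrank F V = 2 * l)
    (h : Fin l × Fin 2 → V)
    (hh : ∀ s t, Q.associated (h s) (h t) = if s = t then (![1, -1] : Fin 2 → F) s.2 else 0) :
    IsHyperbolic Q := by
  have hne : ∀ j : Fin 2, (![1, -1] : Fin 2 → F) j ≠ 0 := by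
    intro j; fin_cases j <;> simp
  have hli : LinearIndependent F h := by
    refine LinearMap.linearIndependent_of_isOrthoᵢ (B := Q.associated) ?_ ?_
    · rw [LinearMap.isOrthoᵢ_def]
      intro s t hst
      rw [hh, if_neg hst]
    · intro s hs
      rw [hh, if_pos rfl] at hs
      exact hne _ hs
  have : Nonempty (Fin l × Fin 2) := ⟨(⟨0, h0⟩, 0)⟩
  let b := basisOfLinearIndependentOfCardEqFinrank hli (by simp [hl, mul_comm])
  refine ⟨l, equivalent_of_basis b
    ((Pi.basis fun _ : Fin l => Pi.basisFun F (Fin 2)).reindex (Equiv.sigmaEquivProd _ _)) ?_⟩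
  rintro ⟨i, j⟩ ⟨i', j'⟩
  simp only [b, coe_basisOfLinearIndependentOfCardEqFinrank, hh]
  simp [Pi.basis_apply, hyperbolicPlane, associated_diag, QuadraticMap.Ring.associated_pi]
  by_cases hi : i = i'
  · subst hi
    rw [Finset.sum_eq_single i (fun c _ hc => by simp [hc]) (by simp)]
    fin_cases j <;> fin_cases j' <;> simp
  · rw [if_neg (fun h => hi h.1), Finset.sum_eq_zero]
    intro c _
    by_cases hc : c = i
    · subst hc; simp [hi]
    · simp [hc]

end Basis

/-! ### Skew-adjoint square roots of scalars -/

section SkewRoot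

variable {F : Type*} [Field F] [Invertible (2 : F)] {V : Type*} [AddCommGroup V] [Module F V]
  {W : Type*} [AddCommGroup W] [Module F W]

/-- `J` is a skew-adjoint square root of the scalar `d`. -/
structure IsSkewRoot (q : QuadraticForm F V) (d : F) (J : V →ₗ[F] V) : Prop where
  sq : ∀ x, J (J x) = d • x
  skew : ∀ x y, q.associated (J x) y = -q.associated x (J y)

theorem IsSkewRoot.of_equivalent {q : QuadraticForm F V} {q' : QuadraticForm F W} {d : F}
    {J : W →ₗ[F] W} (hJ : IsSkewRoot q' d J) (h : q.Equivalent q') :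
    ∃ J', IsSkewRoot q d J' := by
  obtain ⟨e⟩ := h
  have he : ∀ x y, q.associated x y = q'.associated (e x) (e y) := fun x y => by
    simp only [QuadraticMap.associated_apply, ← map_add, e.map_app]
  refine ⟨e.toLinearEquiv.symm.toLinearMap ∘ₗ J ∘ₗ e.toLinearEquiv.toLinearMap, ?_, ?_⟩
  · intro x
    simp [hJ.sq]
  · intro x y
    simp [he, hJ.skew]

theorem IsSkewRoot.tmul {q : QuadraticForm F V} {d : F} {J : V →ₗ[F] V} (hJ : IsSkewRoot q d J)
    (q' : QuadraticForm F W) : IsSkewRoot (QuadraticForm.tmul q q') d (J.rTensor W) := by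
  constructor
  · intro x
    induction x with
    | zero => simp
    | add x y hx hy => simp only [map_add, hx, hy, smul_add]
    | tmul x y => simp [hJ.sq, TensorProduct.smul_tmul']
  · intro x y
    rw [QuadraticForm.associated_tmul]
    induction x with
    | zero => simp
    | add x x' hx hx' => simp only [map_add, LinearMap.add_apply, hx, hx', neg_add]
    | tmul x x' =>
      induction y with
      | zero => simp
      | add y y' hy hy' => simp only [map_add, hy, hy', neg_add]
      | tmul y y' => simp [hJ.skew]

/-- The matrix is multiplication by `√-a` on `F(√-a)` in the basis `1, √-a`; its norm form is `⟨1,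
a⟩`. -/
theorem isSkewRoot_diag (a : F) :
    IsSkewRoot (diag ![1, a]) (-a) (Matrix.toLin' !![0, -a; 1, 0]) := by
  constructor
  · intro x
    ext i
    fin_cases i <;> simp [Matrix.mulVec, dotProduct]
  · intro x y
    simp [associated_diag, dotProduct]
    ring

/-- The `w i` are an orthogonal basis of a subspace `W` that is maximal with `B(W, J W) = 0`.
Anisotropy forces `V = W ⊕ J W`, whence the dimension `2 * l`. -/
theorem IsSkewRoot.exists_family [FiniteDimensional F V] {q : QuadraticForm F V}
    (hq : q.Anisotropic) {d : F} (hd : d ≠ 0) {J : V →ₗ[F] V} (hJ : IsSkewRoot q d J) :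
    ∃ (l : ℕ) (w : Fin l → V), Module.finrank F V = 2 * l ∧ (∀ i, w i ≠ 0) ∧
      (∀ i j, i ≠ j → q.associated (w i) (w j) = 0) ∧
      ∀ i j, q.associated (w i) (J (w j)) = 0 := by
  have hB : ∀ x, q.associated x x = q x := fun x => QuadraticMap.associated_eq_self_apply F q x
  have hs : ∀ x y, q.associated x y = q.associated y x := fun x y =>
    (QuadraticMap.associated_isSymm F q x y)
  have hself : ∀ x, q.associated x (J x) = 0 := fun x => by
    have h1 := hJ.skew x x
    rw [hs] at h1
    have h2 : 2 * q.associated x (J x) = 0 := by linear_combination h1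
    exact (mul_eq_zero.1 h2).resolve_left (Invertible.ne_zero 2)
  let S : Set (Submodule F V) := {W | ∀ x ∈ W, ∀ y ∈ W, q.associated x (J y) = 0}
  obtain ⟨W, hW, hmax⟩ := WellFounded.has_min
    (wellFounded_gt : WellFounded ((· > ·) : Submodule F V → Submodule F V → Prop)) S
    ⟨⊥, by rintro x hx y hy; rw [(Submodule.mem_bot F).1 hx]; simp⟩
  have hinj : Function.Injective J := by
    rw [injective_iff_map_eq_zero]
    intro x hx
    have := hJ.sq x
    rw [hx, map_zero] at this
    exact (smul_eq_zero.1 this.symm).resolve_left hd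
  have hdisj : Disjoint W (W.map J) := by
    rw [Submodule.disjoint_def]
    rintro x hx ⟨y, hy, rfl⟩
    have := hW _ hx _ hy
    rw [hB] at this
    exact hq _ this
  have htop : W ⊔ W.map J = ⊤ := by
    -- Otherwise some `x ≠ 0` is orthogonal to both `W` and `J W`. Then `W + F x` still has the
    -- defining property, and it is larger because `x ∈ W` would give `q x = 0`.
    by_contra hne
    obtain ⟨f, hf0, hf⟩ := Submodule.exists_le_ker_of_lt_top _ (lt_top_iff_ne_top.2 hne)
    have hnd : (q.associated).Nondegenerate := by
      rw [QuadraticMap.nondegenerate_associated_iff,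
        QuadraticMap.nondegenerate_iff_radical_eq_bot, eq_bot_iff]
      exact fun x hx => hq x (QuadraticMap.mem_radical_iff'.1 hx).1
    obtain ⟨x, hx⟩ : ∃ x, ∀ y, q.associated x y = f y := by
      refine ⟨(LinearMap.BilinForm.toDual q.associated hnd).symm f, fun y => ?_⟩
      exact LinearMap.BilinForm.apply_toDual_symm_apply (hB := hnd) f y
    have hx0 : x ≠ 0 := by
      rintro rfl
      exact hf0 (LinearMap.ext fun y => by rw [← hx]; simp)
    have h1 : ∀ y ∈ W, q.associated x y = 0 := fun y hy => by
      rw [hx]; exact hf (Submodule.mem_sup_left hy)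
    have h2 : ∀ y ∈ W, q.associated x (J y) = 0 := fun y hy => by
      rw [hx]; exact hf (Submodule.mem_sup_right ⟨y, hy, rfl⟩)
    refine hmax (W ⊔ F ∙ x) ?_ ?_
    · intro y hy z hz
      obtain ⟨y, hyW, _, hy', rfl⟩ := Submodule.mem_sup.1 hy
      obtain ⟨z, hzW, _, hz', rfl⟩ := Submodule.mem_sup.1 hz
      obtain ⟨c, rfl⟩ := Submodule.mem_span_singleton.1 hy'
      obtain ⟨c', rfl⟩ := Submodule.mem_span_singleton.1 hz'
      have h3 : q.associated y (J x) = 0 := by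
        have := hJ.skew y x
        rw [hs, h2 y hyW] at this
        exact neg_eq_zero.1 this.symm
      simp [hW y hyW z hzW, h2 z hzW, h3, hself]
    · refine lt_of_le_of_ne le_sup_left fun h => hx0 (hq _ ?_)
      have : x ∈ W := by
        rw [h]; exact Submodule.mem_sup_right (Submodule.mem_span_singleton_self x)
      rw [← hB]
      exact h1 x this
  have hrank : Module.finrank F V = 2 * Module.finrank F W := by
    have := Submodule.finrank_sup_add_finrank_inf_eq W (W.map J)
    rw [htop, hdisj.eq_bot, finrank_top, finrank_bot,
      ← (Submodule.equivMapOfInjective J hinj W).finrank_eq] at this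
    omega
  obtain ⟨b, hb⟩ := LinearMap.BilinForm.exists_orthogonal_basis
    (B := LinearMap.BilinForm.restrict q.associated W) ⟨fun x y => hs x y⟩
  refine ⟨_, fun i => b i, hrank, fun i => ?_, fun i j hij => ?_, fun i j => hW _ (b i).2 _ (b j).2⟩
  · simpa using b.ne_zero i
  · exact hb hij

/-- The vectors `w i`, `J (w i)` of a family as in `IsSkewRoot.exists_family`. -/
def IsSkewRoot.vec {l : ℕ} (J : V →ₗ[F] V) (w : Fin l → V) (s : Fin 2 × Fin l) : V :=
  ![w s.2, J (w s.2)] s.1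

theorem IsSkewRoot.associated_vec {q : QuadraticForm F V} {d : F} {J : V →ₗ[F] V}
    (hJ : IsSkewRoot q d J) {l : ℕ} {w : Fin l → V}
    (hw : ∀ i j, i ≠ j → q.associated (w i) (w j) = 0)
    (hwJ : ∀ i j, q.associated (w i) (J (w j)) = 0) (s t : Fin 2 × Fin l) :
    q.associated (vec J w s) (vec J w t) =
      if s = t then (![1, -d] : Fin 2 → F) s.1 * q (w s.2) else 0 := by
  have hJw : ∀ i j, q.associated (J (w i)) (w j) = 0 := fun i j => by
    rw [hJ.skew, hwJ, neg_zero]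
  have hJJ : ∀ i j, q.associated (J (w i)) (J (w j)) = -d * q.associated (w i) (w j) := fun i j => by
    rw [hJ.skew, hJ.sq, map_smul, smul_eq_mul, neg_mul]
  have hqq : ∀ x, q.associated x x = q x := fun x => QuadraticMap.associated_eq_self_apply F q x
  obtain ⟨i, j⟩ := s
  obtain ⟨i', j'⟩ := t
  by_cases hj : j = j'
  · subst hj
    fin_cases i <;> fin_cases i' <;> simp [vec, hwJ, hJw, hJJ, hqq]
  · have hne : (i, j) ≠ (i', j') := fun h => hj (congrArg Prod.snd h)
    rw [if_neg hne]
    fin_cases i <;> fin_cases i' <;> simp [vec, hwJ, hJw, hJJ, hw _ _ hj]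

/-- The vectors `w i`, `J (w i)` form an orthogonal basis with values `q (w i)` and `-d * q (w i)`.
-/
theorem IsSkewRoot.equivalent_tmul [FiniteDimensional F V] {q : QuadraticForm F V}
    (hpos : 0 < Module.finrank F V) (hq : q.Anisotropic) {d : F} (hd : d ≠ 0) {J : V →ₗ[F] V}
    (hJ : IsSkewRoot q d J) :
    ∃ (l : ℕ) (c : Fin l → F), IsForm (diag c) ∧
      q.Equivalent (QuadraticForm.tmul (diag ![1, -d]) (diag c)) := by
  obtain ⟨l, w, hl, hw0, hw, hwJ⟩ := hJ.exists_family hq hd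
  have hc : ∀ i, q (w i) ≠ 0 := fun i h => hw0 i (hq _ h)
  have hl0 : 0 < l := by omega
  have hv := hJ.associated_vec hw hwJ
  have hli : LinearIndependent F (vec J w) := by
    refine LinearMap.linearIndependent_of_isOrthoᵢ (B := q.associated)
      (LinearMap.isOrthoᵢ_def.2 fun s t hst => by rw [hv, if_neg hst]) fun s hs => ?_
    rw [hv, if_pos rfl, mul_eq_zero] at hs
    obtain ⟨i, j⟩ := s
    have := hc j
    fin_cases i <;> simp_all
  have : Nonempty (Fin 2 × Fin l) := ⟨(0, ⟨0, hl0⟩)⟩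
  refine ⟨l, fun i => q (w i), isForm_diag hl0 _ hc, equivalent_of_basis
    (basisOfLinearIndependentOfCardEqFinrank hli (by simp [hl]))
    ((Pi.basisFun F (Fin 2)).tensorProduct (Pi.basisFun F (Fin l))) fun s t => ?_⟩
  rw [coe_basisOfLinearIndependentOfCardEqFinrank, hv, QuadraticForm.associated_tmul]
  obtain ⟨i, j⟩ := s
  obtain ⟨i', j'⟩ := t
  simp [Module.Basis.tensorProduct_apply, associated_diag, Pi.single_apply]
  rcases eq_or_ne i i' with rfl | hi <;> rcases eq_or_ne j j' with rfl | hj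
  · simp [mul_comm]
  · simp [hj, hj.symm]
  · simp [hi, hi.symm]
  · simp [hi, hi.symm]

/-- Once `d = s²`, the plane spanned by `w i` and `J (w i) / s` is `⟨c, -c⟩` with `c = q (w i)`,
which is a hyperbolic plane. -/
theorem IsSkewRoot.isHyperbolic_baseChange [FiniteDimensional F V] {q : QuadraticForm F V}
    (hpos : 0 < Module.finrank F V) (hq : q.Anisotropic) {d : F} (hd : d ≠ 0) {J : V →ₗ[F] V}
    (hJ : IsSkewRoot q d J) (E : Type*) [Field E] [Algebra F E] (s : E)
    (hs : s * s = algebraMap F E d) : IsHyperbolic (q.baseChange E) := by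
  obtain ⟨l, w, hl, hw0, hw, hwJ⟩ := hJ.exists_family hq hd
  have hc : ∀ i, algebraMap F E (q (w i)) ≠ 0 := fun i h =>
    hw0 i (hq _ ((map_eq_zero _).1 h))
  have hv := hJ.associated_vec hw hwJ
  let _ : Invertible (2 : E) := (Invertible.map (algebraMap F E) 2).copy 2 (map_ofNat _ _).symm
  have hs0 : s ≠ 0 := by
    rintro rfl
    rw [zero_mul] at hs
    exact hd ((map_eq_zero _).1 hs.symm)
  let c : Fin l → E := fun i => algebraMap F E (q (w i))
  -- Solution of `x + y = 1`, `x - y = c⁻¹`, so that `x² - y² = c⁻¹`.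
  let x : Fin l → E := fun i => ⅟2 * (1 + (c i)⁻¹)
  let y : Fin l → E := fun i => ⅟2 * (1 - (c i)⁻¹)
  have hxy : ∀ i, c i * (x i * x i - y i * y i) = 1 := fun i => by
    have h2 : (⅟2 : E) * 2 = 1 := invOf_mul_self 2
    have h3 : c i * (c i)⁻¹ = 1 := mul_inv_cancel₀ (hc i)
    simp only [x, y]
    linear_combination (⅟2 * 2 * (c i * (c i)⁻¹) + c i * (c i)⁻¹) * h2 + h3
  refine isHyperbolic_of_family (l := l) (by omega) (by simp [hl]) (fun t =>
    ![x t.1 ⊗ₜ w t.1 + (y t.1 / s) ⊗ₜ J (w t.1), y t.1 ⊗ₜ w t.1 + (x t.1 / s) ⊗ₜ J (w t.1)] t.2) ?_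
  have h00 : ∀ i j, q.associated (w i) (w j) = if i = j then q (w i) else 0 := fun i j => by
    simpa [vec] using hv (0, i) (0, j)
  have h01 : ∀ i j, q.associated (w i) (J (w j)) = 0 := hwJ
  have h10 : ∀ i j, q.associated (J (w i)) (w j) = 0 := fun i j => by
    simpa [vec] using hv (1, i) (0, j)
  have h11 : ∀ i j, q.associated (J (w i)) (J (w j)) = if i = j then -(d * q (w i)) else 0 :=
    fun i j => by simpa [vec] using hv (1, i) (1, j)
  rintro ⟨i, a⟩ ⟨j, b⟩
  rw [QuadraticForm.associated_baseChange]
  by_cases hij : i = j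
  · subst hij
    have := hxy i
    simp only [c] at this
    fin_cases a <;> fin_cases b <;> simp [h00, h01, h10, h11, Algebra.smul_def, ← hs] <;>
      field_simp
    · linear_combination this
    · ring
    · ring
    · linear_combination -this
  · have hne : (i, a) ≠ (j, b) := fun h => hij (congrArg Prod.fst h)
    rw [if_neg hne]
    fin_cases a <;> fin_cases b <;> simp [h00, h01, h10, h11, hij]

end SkewRoot

/-! ### Lagrangians, their specialization and their descent -/

section Metabolic

/-- The diagonal form `a` has, over the extension `E`, a totally isotropic subspace of half the
dimension. -/
def Metabolic {F : Type*} [Field F] {n : ℕ} (a : Fin n → F) (E : Type*) [Field E] [Algebra F E] :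
    Prop :=
  ∃ i : ℕ, n = 2 * i ∧ ∃ e : Fin i → Fin n → E, LinearIndependent E e ∧
    ∀ k l, ∑ c, algebraMap F E (a c) * e k c * e l c = 0

variable {F : Type*} [Field F] {n : ℕ} {a : Fin n → F}

theorem metabolic_of_isHyperbolic_baseChange [Invertible (2 : F)] {V : Type*} [AddCommGroup V]
    [Module F V] {q : QuadraticForm F V} (h : q.Equivalent (diag a)) {E : Type*} [Field E]
    [Algebra F E] (hE : IsHyperbolic (q.baseChange E)) : Metabolic a E := by
  let _ : Invertible (2 : E) := (Invertible.map (algebraMap F E) 2).copy 2 (map_ofNat _ _).symm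
  obtain ⟨e⟩ := h
  have he : ∀ x y, q.associated (e.symm x) (e.symm y) = (diag a).associated x y := fun x y => by
    simp only [QuadraticMap.associated_apply, ← map_add, e.symm.map_app]
  have h1 : (q.baseChange E).Equivalent (diag fun i => algebraMap F E (a i)) := by
    refine equivalent_of_basis
      (((Pi.basisFun F (Fin n)).map e.toLinearEquiv.symm).baseChange E)
      (Pi.basisFun E (Fin n)) fun i j => ?_
    have := he (Pi.single i 1) (Pi.single j 1)
    rw [QuadraticForm.associated_baseChange]
    simp [this, associated_diag, Pi.single_apply, Algebra.smul_def, apply_ite (algebraMap F E)]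
  obtain ⟨i, hi⟩ := hE
  obtain ⟨f⟩ := hi.symm.trans h1
  have hf : ∀ x y, (diag fun i => algebraMap F E (a i)).associated (f x) (f y) =
      (QuadraticMap.pi fun _ : Fin i => hyperbolicPlane E).associated x y := fun x y => by
    simp only [QuadraticMap.associated_apply, ← map_add, f.map_app]
  have hdim := f.toLinearEquiv.finrank_eq
  -- The Lagrangian is spanned by the isotropic vector `(1, 1)` of each hyperbolic plane.
  refine ⟨i, by simpa [mul_comm, Module.finrank_pi_fintype] using hdim.symm, fun k => f (Pi.single k ![1, 1]), ?_, fun k l => ?_⟩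
  · have h2 : LinearIndependent E fun k : Fin i => (Pi.single k ![1, 1] : Fin i → Fin 2 → E) := by
      rw [Fintype.linearIndependent_iff]
      intro g hg k
      have := congrFun (congrFun hg k) 0
      simpa [Finset.sum_apply, Pi.single_apply, ite_apply] using this
    exact h2.map' f.toLinearEquiv.toLinearMap (LinearMap.ker_eq_bot.2 f.toLinearEquiv.injective)
  · have := hf (Pi.single k ![1, 1]) (Pi.single l ![1, 1])
    rw [associated_diag] at this
    rw [this, QuadraticMap.Ring.associated_pi]
    simp only [LinearMap.sum_apply, LinearMap.compl₁₂_apply, LinearMap.proj_apply, hyperbolicPlane,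
      associated_diag, Fin.sum_univ_two]
    refine Finset.sum_eq_zero fun c _ => ?_
    rcases eq_or_ne c k with rfl | hk
    · rcases eq_or_ne c l with rfl | hl <;> simp [*]
    · simp [hk]

theorem Metabolic.not_anisotropic (h : Metabolic a F) (hn : 0 < n) : ¬ (diag a).Anisotropic := by
  obtain ⟨i, hi, e, he, hiso⟩ := h
  intro hq
  have := hiso ⟨0, by omega⟩ ⟨0, by omega⟩
  refine he.ne_zero ⟨0, by omega⟩ (hq _ ?_)
  simpa [diag, mul_assoc] using this

theorem linearIndependent_of_sum_mul {E : Type*} [Field E] {i n : ℕ} {e : Fin i → Fin n → E}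
    {D : Fin n → Fin i → E} {t : E} (ht : t ≠ 0)
    (h : ∀ k l, ∑ c, e k c * D c l = if k = l then t else 0) : LinearIndependent E e := by
  rw [Fintype.linearIndependent_iff]
  intro g hg l
  have h1 : ∑ c, (∑ k, g k • e k) c * D c l = 0 := by rw [hg]; simp
  simp only [Finset.sum_apply, Pi.smul_apply, smul_eq_mul, Finset.sum_mul] at h1
  rw [Finset.sum_comm] at h1
  simp only [mul_assoc, ← Finset.mul_sum, h] at h1
  simpa [ht] using h1

/-- A right inverse `D` certifies independence by polynomial identities, which, unlike independence
itself, pass through ring homomorphisms. -/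
theorem exists_sum_mul_eq {E : Type*} [Field E] {i n : ℕ} {e : Fin i → Fin n → E}
    (h : LinearIndependent E e) :
    ∃ D : Fin n → Fin i → E, ∀ k l, ∑ c, e k c * D c l = if k = l then 1 else 0 := by
  obtain ⟨g, hg⟩ := (Fintype.linearCombination E e).exists_leftInverse_of_injective
    (LinearMap.ker_eq_bot.2 (linearIndependent_iff_injective_fintypeLinearCombination.1 h))
  refine ⟨fun c => g (Pi.single c 1), fun k l => ?_⟩
  have h1 := congrFun (LinearMap.congr_fun hg (Pi.single k 1)) l
  have h2 : e k = ∑ c, e k c • (Pi.single c 1 : Fin n → E) := by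
    ext c
    simp [Finset.sum_apply, Pi.single_apply]
  rw [LinearMap.comp_apply, Fintype.linearCombination_apply_single, one_smul, h2] at h1
  simpa [Finset.sum_apply, Pi.single_apply, eq_comm] using h1

theorem exists_smul_eq_map {R L : Type*} [CommRing R] [IsDomain R] [Field L] [Algebra R L]
    [IsFractionRing R L] {ι κ : Type*} [Finite ι] [Finite κ] (e : ι → κ → L) :
    ∃ (c : R) (e' : ι → κ → R), c ≠ 0 ∧
      ∀ k l, algebraMap R L (e' k l) = algebraMap R L c * e k l := by
  obtain ⟨⟨c, hc⟩, h⟩ := IsLocalization.exist_integer_multiples_of_finite (nonZeroDivisors R)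
    (fun s : ι × κ => e s.1 s.2)
  choose e' he' using h
  refine ⟨c, fun k l => e' (k, l), nonZeroDivisors.ne_zero hc, fun k l => ?_⟩
  simpa only [Algebra.smul_def] using he' (k, l)

/-- Specialization along homomorphisms that do not kill a prescribed element. -/
theorem Metabolic.specialize {R L E : Type*} [CommRing R] [IsDomain R] [Algebra F R] [Field L]
    [Algebra R L] [IsFractionRing R L] [Algebra F L] [IsScalarTower F R L] [Field E] [Algebra F E]
    (hR : ∀ f : R, f ≠ 0 → ∃ φ : R →ₐ[F] E, φ f ≠ 0) (h : Metabolic a L) : Metabolic a E := by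
  obtain ⟨i, hi, e, he, hiso⟩ := h
  obtain ⟨D, hD⟩ := exists_sum_mul_eq he
  obtain ⟨t, e', ht, he'⟩ := exists_smul_eq_map (R := R) e
  obtain ⟨t', D', ht', hD'⟩ := exists_smul_eq_map (R := R) D
  have hinj : Function.Injective (algebraMap R L) := IsFractionRing.injective R L
  -- After denominators are cleared, independence and isotropy become identities in `R`; `φ`
  -- preserves them, and only `t * t'` has to survive.
  have hmul : ∀ k l, ∑ c, e' k c * D' c l = if k = l then t * t' else 0 := fun k l => by
    apply hinj
    have h1 := congrArg (algebraMap R L (t * t') * ·) (hD k l)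
    simp only [mul_ite, mul_one, mul_zero, Finset.mul_sum] at h1
    rw [apply_ite (algebraMap R L), map_zero, ← h1]
    simp only [map_sum, map_mul, he', hD']
    exact Finset.sum_congr rfl fun j _ => by ring
  have hiso' : ∀ k l, ∑ j, algebraMap F R (a j) * e' k j * e' l j = 0 := fun k l => by
    apply hinj
    simp only [map_sum, map_mul, he', map_zero, ← IsScalarTower.algebraMap_apply]
    rw [← mul_zero (algebraMap R L t * algebraMap R L t), ← hiso k l, Finset.mul_sum]
    exact Finset.sum_congr rfl fun j _ => by ring
  obtain ⟨φ, hφ⟩ := hR (t * t') (mul_ne_zero ht ht')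
  refine ⟨i, hi, fun k c => φ (e' k c), linearIndependent_of_sum_mul (D := fun c l => φ (D' c l)) hφ
    fun k l => ?_, fun k l => ?_⟩
  · have := congrArg φ (hmul k l)
    simpa only [map_sum, map_mul, apply_ite φ, map_zero] using this
  · have := congrArg φ (hiso' k l)
    simpa only [map_sum, map_mul, map_zero, AlgHom.commutes] using this

theorem sum_eq_zero_of_mem_span {E : Type*} [Field E] {ι : Type*} {b : Fin n → E}
    {e : ι → Fin n → E} (h : ∀ k l, ∑ c, b c * e k c * e l c = 0) {x y : Fin n → E}
    (hx : x ∈ Submodule.span E (Set.range e)) (hy : y ∈ Submodule.span E (Set.range e)) :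
    ∑ c, b c * x c * y c = 0 := by
  induction hx using Submodule.span_induction with
  | zero => simp
  | add x x' _ _ h1 h2 => simp only [Pi.add_apply, mul_add, add_mul, Finset.sum_add_distrib, h1, h2,
      add_zero]
  | smul t x _ h1 =>
    rw [← mul_zero t, ← h1, Finset.mul_sum]
    exact Finset.sum_congr rfl fun c _ => by simp; ring
  | mem x hx =>
    obtain ⟨k, rfl⟩ := hx
    induction hy using Submodule.span_induction with
    | zero => simp
    | add x x' _ _ h1 h2 => simp only [Pi.add_apply, mul_add, Finset.sum_add_distrib, h1, h2,
        add_zero]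
    | smul t x _ h1 =>
      rw [← mul_zero t, ← h1, Finset.mul_sum]
      exact Finset.sum_congr rfl fun c _ => by simp; ring
    | mem y hy =>
      obtain ⟨l, rfl⟩ := hy
      exact h k l

open Polynomial in
-- The polynomial vectors in the Lagrangian form a saturated, hence free, `K[X]`-module `M`.
-- Saturation keeps a basis of `M` independent after evaluation at `X = 0`.
theorem Metabolic.of_rational_function {K L : Type*} [Field K] [Algebra F K] [Field L]
    [Algebra K[X] L] [IsFractionRing K[X] L] [Algebra F L] [IsScalarTower F K[X] L]
    (h : Metabolic a L) : Metabolic a K := by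
  obtain ⟨i, hi, e, he, hiso⟩ := h
  have hinj : Function.Injective (algebraMap K[X] L) := IsFractionRing.injective K[X] L
  let Φ : (Fin n → K[X]) →ₗ[K[X]] (Fin n → L) := (Algebra.linearMap K[X] L).compLeft (Fin n)
  have hΦ : ∀ x c, Φ x c = algebraMap K[X] L (x c) := fun x c => rfl
  have hΦinj : Function.Injective Φ := fun x y hxy => funext fun c => hinj (congrFun hxy c)
  let M : Submodule K[X] (Fin n → K[X]) :=
    ((Submodule.span L (Set.range e)).restrictScalars K[X]).comap Φ
  have hM : ∀ x, x ∈ M ↔ Φ x ∈ Submodule.span L (Set.range e) := fun x => Iff.rfl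
  obtain ⟨r, ⟨b⟩⟩ := Submodule.nonempty_basis_of_pid (Pi.basisFun K[X] (Fin n)) M
  have hir : i ≤ r := by
    obtain ⟨c, e', hc, he'⟩ := exists_smul_eq_map (R := K[X]) e
    have hc' : algebraMap K[X] L c ≠ 0 := fun h => hc (hinj (by rw [h, map_zero]))
    have he'' : ∀ k, Φ (e' k) = algebraMap K[X] L c • e k := fun k => funext (he' k)
    have hmem : ∀ k, e' k ∈ M := fun k => by
      rw [hM, he'']
      exact Submodule.smul_mem _ _ (Submodule.subset_span ⟨k, rfl⟩)
    have hli : LinearIndependent K[X] fun k => (⟨e' k, hmem k⟩ : M) := by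
      have h1 : LinearIndependent L fun k => Φ (e' k) := by
        simp only [he'']
        exact he.units_smul fun _ => Units.mk0 _ hc'
      have h2 : LinearIndependent K[X] fun k => Φ (e' k) := h1.restrict_scalars' K[X]
      exact LinearIndependent.of_comp (Φ ∘ₗ M.subtype) h2
    have : Module.Finite K[X] M := .of_basis b
    simpa [Module.finrank_eq_card_basis b] using hli.fintype_card_le_finrank
  have hsum : ∀ x ∈ M, ∀ y ∈ M, ∑ c, algebraMap F K[X] (a c) * x c * y c = 0 := fun x hx y hy => by
    apply hinj
    have := sum_eq_zero_of_mem_span hiso ((hM x).1 hx) ((hM y).1 hy)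
    simpa only [map_sum, map_mul, map_zero, ← IsScalarTower.algebraMap_apply, hΦ] using this
  let ev : Fin r → Fin n → K := fun k c => ((b k : Fin n → K[X]) c).eval 0
  have hev : LinearIndependent K ev := by
    rw [Fintype.linearIndependent_iff]
    intro g hg k
    -- A relation among the values at `0` lifts to an element of `M` divisible by `X`. The quotient
    -- lies in `M` again, so `X` divides each constant coefficient `g k`, which therefore vanishes.
    let x : M := ∑ k, C (g k) • b k
    have hx : ∀ c, X ∣ (x : Fin n → K[X]) c := fun c => by
      rw [X_dvd_iff, coeff_zero_eq_eval_zero]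
      have := congrFun hg c
      simpa [x, ev, Finset.sum_apply, eval_finsetSum] using this
    choose y hy using hx
    have hyM : y ∈ M := by
      rw [hM]
      have h1 : Φ x = algebraMap K[X] L X • Φ y := by
        ext c
        simp [hΦ, hy]
      have h2 : algebraMap K[X] L X ≠ 0 := fun h => X_ne_zero (hinj (by rw [h, map_zero]))
      have h3 := (hM _).1 x.2
      rw [h1] at h3
      exact (Submodule.smul_mem_iff _ h2).1 h3
    have hxy : x = (X : K[X]) • (⟨y, hyM⟩ : M) := by
      ext1; ext1 c
      simp [hy]
    have h4 := congrArg (fun z => b.repr z k) hxy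
    simp only [x, map_sum, map_smul, Finsupp.smul_apply, smul_eq_mul,
      Module.Basis.repr_self, Finsupp.finsetSum_apply] at h4
    have h5 := congrArg (eval 0) h4
    simpa [Finsupp.single_apply] using h5
  refine ⟨i, hi, fun k => ev (Fin.castLE hir k), hev.comp _ (Fin.castLE_injective hir), fun k l => ?_⟩
  have := congrArg (eval 0) (hsum _ (b (Fin.castLE hir k)).2 _ (b (Fin.castLE hir l)).2)
  simpa [eval_finsetSum, Polynomial.algebraMap_apply] using this

/-- On the Lagrangian `L`, a vector with zero imaginary part has an isotropic real part, so it
vanishes. As `L` has `F`-dimension `2 * i = n`, `im` is bijective on `L`, and `J` sends `im z` to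
`re z`. Stability of `L` under `√d` gives `J² = d`; the imaginary part of the isotropy relation
gives skewness. -/
theorem Metabolic.exists_isSkewRoot [Invertible (2 : F)] {d : F} [Fact (∀ r : F, r ^ 2 ≠ d + 0 * r)]
    (ha : (diag a).Anisotropic) (h : Metabolic a (QuadraticAlgebra F d 0)) :
    ∃ J, IsSkewRoot (diag a) d J := by
  obtain ⟨i, hi, e, he, hiso⟩ := h
  let K := QuadraticAlgebra F d 0
  let L : Submodule K (Fin n → K) := Submodule.span K (Set.range e)
  let re : (Fin n → K) →ₗ[F] (Fin n → F) :=
    { toFun := fun x c => (x c).re, map_add' := fun x y => rfl, map_smul' := fun t x => rfl }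
  let im : (Fin n → K) →ₗ[F] (Fin n → F) :=
    { toFun := fun x c => (x c).im, map_add' := fun x y => rfl, map_smul' := fun t x => rfl }
  have hre : ∀ x ∈ L, ∀ y ∈ L, (diag a).associated (re x) (re y) +
      d * (diag a).associated (im x) (im y) = 0 := fun x hx y hy => by
    have := congrArg QuadraticAlgebra.re (sum_eq_zero_of_mem_span hiso hx hy)
    have h1 : ∀ z : K, z.re = QuadraticAlgebra.reₗ d 0 z := fun _ => rfl
    rw [h1, map_sum] at this
    rw [associated_diag, associated_diag, Finset.mul_sum, ← Finset.sum_add_distrib]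
    refine (Finset.sum_congr rfl fun c _ => ?_).trans this
    simp [re, im, K]
    ring
  have him : ∀ x ∈ L, ∀ y ∈ L, (diag a).associated (re x) (im y) +
      (diag a).associated (im x) (re y) = 0 := fun x hx y hy => by
    have := congrArg QuadraticAlgebra.im (sum_eq_zero_of_mem_span hiso hx hy)
    have h1 : ∀ z : K, z.im = QuadraticAlgebra.imₗ d 0 z := fun _ => rfl
    rw [h1, map_sum] at this
    rw [associated_diag, associated_diag, ← Finset.sum_add_distrib]
    refine (Finset.sum_congr rfl fun c _ => ?_).trans this
    simp [re, im, K]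
  let f : L.restrictScalars F →ₗ[F] (Fin n → F) := im ∘ₗ (L.restrictScalars F).subtype
  have hf : Function.Injective f := by
    rw [injective_iff_map_eq_zero]
    rintro ⟨x, hx⟩ h0
    have h0' : im x = 0 := h0
    have h1 := hre x hx x hx
    rw [h0', map_zero, mul_zero, add_zero, QuadraticMap.associated_eq_self_apply] at h1
    have h2 := ha _ h1
    ext c
    · exact congrFun h2 c
    · exact congrFun h0' c
  have hdim : Module.finrank F (L.restrictScalars F) = Module.finrank F (Fin n → F) := by
    have h1 : Module.finrank K L = i := by
      simpa using finrank_span_eq_card he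
    have h2 := Module.finrank_mul_finrank F K L
    rw [h1, QuadraticAlgebra.finrank_eq_two] at h2
    rw [Module.finrank_fin_fun]
    exact h2.symm.trans hi.symm
  let g := LinearEquiv.ofInjectiveOfFinrankEq f hf hdim
  let J : (Fin n → F) →ₗ[F] (Fin n → F) := re ∘ₗ (L.restrictScalars F).subtype ∘ₗ g.symm.toLinearMap
  have hg : ∀ w, im (g.symm w : Fin n → K) = w := fun w => g.apply_symm_apply w
  have hJ : ∀ x ∈ L, J (im x) = re x := fun x hx => by
    have : g.symm (im x) = ⟨x, hx⟩ := g.symm_apply_apply ⟨x, hx⟩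
    simp [J, this]
  refine ⟨J, fun x => ?_, fun x y => ?_⟩
  · obtain ⟨z, hz⟩ : ∃ z : L, im z = x := ⟨g.symm x, hg x⟩
    have h1 := hJ _ (L.smul_mem (QuadraticAlgebra.omega : K) z.2)
    have h2 : im ((QuadraticAlgebra.omega : K) • (z : Fin n → K)) = re z := by
      ext c; simp [im, re]
    have h3 : re ((QuadraticAlgebra.omega : K) • (z : Fin n → K)) = d • im z := by
      ext c; simp [im, re]
    rw [← hz, hJ _ z.2, ← h2, h1, h3]
  · obtain ⟨z, rfl⟩ : ∃ z : L, im z = x := ⟨g.symm x, hg x⟩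
    obtain ⟨t, rfl⟩ : ∃ z : L, im z = y := ⟨g.symm y, hg y⟩
    rw [hJ _ z.2, hJ _ t.2]
    exact eq_neg_of_add_eq_zero_left (him _ z.2 _ t.2)

end Metabolic

/-! ### Extension of scalars in coordinates -/

section Quadric

variable {F : Type*} [Field F] [Invertible (2 : F)] {m : ℕ}

/-- The form on `E ^ m` with the same matrix as the form `p` on `F ^ m`. -/
def extend (p : QuadraticForm F (Fin m → F)) (E : Type*) [Field E] [Algebra F E] :
    QuadraticForm E (Fin m → E) :=
  (p.toMatrix'.map (algebraMap F E)).toQuadraticForm'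

variable {E : Type*} [Field E] [Algebra F E] [Invertible (2 : E)]

theorem associated_extend (p : QuadraticForm F (Fin m → F)) :
    (extend p E).associated = Matrix.toLinearMap₂' E (p.toMatrix'.map (algebraMap F E)) := by
  refine QuadraticMap.associated_left_inverse E fun x y => ?_
  have hs : ∀ i j, p.toMatrix' i j = p.toMatrix' j i := fun i j =>
    congrFun (congrFun p.isSymm_toMatrix' j) i
  simp only [Matrix.toLinearMap₂'_apply, Matrix.map_apply, smul_eq_mul]
  rw [Finset.sum_comm]
  refine Finset.sum_congr rfl fun i _ => Finset.sum_congr rfl fun j _ => ?_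
  rw [hs]
  ring

theorem toMatrix'_extend (p : QuadraticForm F (Fin m → F)) :
    (extend p E).toMatrix' = p.toMatrix'.map (algebraMap F E) := by
  rw [QuadraticForm.toMatrix', associated_extend, LinearMap.toMatrix'_toLinearMap₂']

theorem poly_extend (p : QuadraticForm F (Fin m → F)) :
    poly (extend p E) = MvPolynomial.map (algebraMap F E) (poly p) := by
  simp [poly, toMatrix'_extend]

theorem aeval_poly (p : QuadraticForm F (Fin m → F)) (x : Fin m → E) :
    MvPolynomial.aeval x (poly p) = extend p E x := by
  rw [← eval_poly, poly_extend, MvPolynomial.eval_map, MvPolynomial.aeval_def]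

theorem extend_algebraMap (p : QuadraticForm F (Fin m → F)) (x : Fin m → F) :
    extend p E (fun i => algebraMap F E (x i)) = algebraMap F E (p x) := by
  rw [← aeval_poly, ← eval_poly]
  exact MvPolynomial.aeval_algebraMap_apply (B := E) x (poly p)

theorem isForm_extend {p : QuadraticForm F (Fin m → F)} (hp : IsForm p) :
    IsForm (extend p E) := by
  refine ⟨inferInstance, by simpa using hp.pos, ?_⟩
  rw [← QuadraticMap.nondegenerate_associated_iff, associated_extend,
    LinearMap.nondegenerate_toLinearMap₂'_iff_det_ne_zero, ← RingHom.mapMatrix_apply, ← RingHom.map_det]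
  have h := QuadraticMap.nondegenerate_associated_iff.2 hp.nondegenerate
  rw [← Matrix.toLinearMap₂'_toMatrix' (R := F) p.associated,
    LinearMap.nondegenerate_toLinearMap₂'_iff_det_ne_zero] at h
  exact fun h0 => h ((map_eq_zero _).1 h0)

theorem poly_extend_irreducible {p : QuadraticForm F (Fin m → F)} (hp : IsForm p) (hm : 3 ≤ m) :
    Irreducible (poly (extend p E)) := by
  refine poly_irreducible _ (isForm_extend hp) ?_
  rintro (h | ⟨⟨e⟩⟩)
  · omega
  · have := e.toLinearEquiv.finrank_eq
    simp at this
    omega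

end Quadric

/-! ### Polynomials vanishing on a quadric -/

section Density

open MvPolynomial

/-- An `F`-linear retraction `E → F`, applied to the coefficients of the quotient, yields a quotient
over `F`. -/
theorem dvd_of_map_dvd_map {F E σ : Type*} [Field F] [Field E] [Algebra F E]
    {p f : MvPolynomial σ F}
    (h : map (algebraMap F E) p ∣ map (algebraMap F E) f) : p ∣ f := by
  classical
  obtain ⟨g, hg⟩ := h
  obtain ⟨ρ, hρ⟩ := (Algebra.linearMap F E).exists_leftInverse_of_injective
    (LinearMap.ker_eq_bot.2 (algebraMap F E).injective)
  have hρ' : ∀ x, ρ (algebraMap F E x) = x := fun x => LinearMap.congr_fun hρ x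
  let g' : MvPolynomial σ F := ∑ n ∈ g.support, monomial n (ρ (coeff n g))
  have hg' : ∀ n, coeff n g' = ρ (coeff n g) := fun n => by
    by_cases h : coeff n g = 0 <;> simp [g', coeff_sum, coeff_monomial, h]
  refine ⟨g', ?_⟩
  ext n
  have h1 := congrArg (fun z => ρ (coeff n z)) hg
  simp only [coeff_map, hρ', coeff_mul, map_sum] at h1
  rw [h1, coeff_mul]
  refine Finset.sum_congr rfl fun s _ => ?_
  rw [hg', ← Algebra.smul_def, map_smul, smul_eq_mul]

variable {E : Type*} [Field E] [Invertible (2 : E)] {m : ℕ}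

/-- A polynomial vanishing on a quadric with a smooth rational point is divisible by the equation
of the quadric. -/
theorem poly_dvd_of_forall_zero [Infinite E] {p : QuadraticForm E (Fin m → E)} (hp : IsForm p)
    (hirr : Irreducible (poly p)) {e : Fin m → E} (he : e ≠ 0) (hpe : p e = 0)
    {f : MvPolynomial (Fin m) E} (hf : ∀ x, p x = 0 → eval x f = 0) : poly p ∣ f := by
  -- Since `p e = 0`, `p (y + t e) = p y + t * L y` is affine in `t`. Thus `y - (p y / L y) e` lies
  -- on the quadric whenever `L y ≠ 0`.
  let L : MvPolynomial (Fin m) E := ∑ j, C (QuadraticMap.polar p e (Pi.single j 1)) * X j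
  have hL : ∀ y, eval y L = QuadraticMap.polar p e y := fun y => by
    have h1 : y = ∑ j, y j • (Pi.single j 1 : Fin m → E) := by
      ext c
      simp [Finset.sum_apply, Pi.single_apply]
    rw [← QuadraticMap.polarBilin_apply_apply]
    conv_rhs => rw [h1]
    simp [L, mul_comm]
  have hL0 : L ≠ 0 := by
    intro h0
    refine he ?_
    have h1 : e ∈ p.radical := by
      rw [QuadraticMap.radical_eq_ker_polarBilin]
      ext j
      simp [← hL, h0]
    rw [hp.nondegenerate.radical_eq_bot] at h1
    simpa using h1
  have hLdeg : L.IsHomogeneous 1 := IsHomogeneous.sum _ _ _ fun j _ => isHomogeneous_C_mul_X _ _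
  have hpL : ¬ poly p ∣ L := by
    rintro ⟨h, hh⟩
    have hh0 : h ≠ 0 := fun h0 => hL0 (by rw [hh, h0, mul_zero])
    have h1 := totalDegree_mul_of_isDomain hirr.ne_zero hh0
    rw [← hh, hLdeg.totalDegree hL0, (poly_isHomogeneous p).totalDegree hirr.ne_zero] at h1
    omega
  -- Modulo `p` the projection along `e` is the identity, so after clearing powers of `L` it changes
  -- `f` only by a multiple of `p`.
  have key : ∀ f : MvPolynomial (Fin m) E, ∃ (N : ℕ) (g : MvPolynomial (Fin m) E), ∀ y,
      eval y L ≠ 0 → eval y L ^ N * eval (y - (p y / eval y L) • e) f =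
        eval y L ^ N * eval y f + p y * eval y g := by
    intro f
    induction f using MvPolynomial.induction_on with
    | C c => exact ⟨0, 0, fun y _ => by simp⟩
    | add f f' h h' =>
      obtain ⟨N, g, h⟩ := h
      obtain ⟨N', g', h'⟩ := h'
      refine ⟨N + N', L ^ N' * g + L ^ N * g', fun y hy => ?_⟩
      simp only [map_add, map_mul, map_pow]
      linear_combination eval y L ^ N' * h y hy + eval y L ^ N * h' y hy
    | mul_X f i h =>
      obtain ⟨N, g, h⟩ := h
      refine ⟨N + 1, L * X i * g - C (e i) * (L ^ N * f + poly p * g), fun y hy => ?_⟩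
      have h1 : eval y L * (y i - p y / eval y L * e i) = eval y L * y i - p y * e i := by
        field_simp
      simp only [map_add, map_mul, map_pow, map_sub, eval_X, eval_C, eval_poly, Pi.sub_apply,
        Pi.smul_apply, smul_eq_mul]
      linear_combination (eval y L * (y i - p y / eval y L * e i)) * h y hy +
        (eval y L ^ N * eval y f + p y * eval y g) * h1
  obtain ⟨N, g, hg⟩ := key f
  -- The extra factor `L` makes the identity hold at every point, including those with `L y = 0`;
  -- `E` being infinite, it holds for polynomials.
  have hzero : L * (L ^ N * f + poly p * g) = 0 := by
    refine MvPolynomial.funext fun y => ?_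
    by_cases hy : eval y L = 0
    · simp [hy]
    · have h1 : p (y - (p y / eval y L) • e) = 0 := by
        have h2 : p (y + (-(p y / eval y L)) • e) = 0 := by
          rw [QuadraticMap.map_add p, QuadraticMap.map_smul, hpe, QuadraticMap.polar_smul_right, QuadraticMap.polar_comm,
            ← hL]
          simp only [smul_eq_mul, mul_zero]
          field_simp
          ring
        rwa [neg_smul, ← sub_eq_add_neg] at h2
      have h3 := hg y hy
      rw [hf _ h1, mul_zero] at h3
      simp [eval_poly, ← h3]
  have h4 := (mul_eq_zero.1 hzero).resolve_left hL0
  have h5 : poly p ∣ L ^ N * f := ⟨-g, by linear_combination h4⟩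
  exact (hirr.prime.dvd_or_dvd h5).resolve_left fun h => hpL (hirr.prime.dvd_of_dvd_pow h)

variable {F : Type*} [Field F] [Invertible (2 : F)]

/-- Case of dimension at least three. -/
theorem poly_dvd_of_three_le [Infinite E] [Algebra F E] {p : QuadraticForm F (Fin m → F)}
    (hp : IsForm p) (hm : 3 ≤ m) {e : Fin m → E} (he : e ≠ 0) (hpe : extend p E e = 0)
    {f : MvPolynomial (Fin m) F} (hf : ∀ x : Fin m → E, extend p E x = 0 → aeval x f = 0) :
    poly p ∣ f := by
  refine dvd_of_map_dvd_map (E := E) ?_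
  rw [← poly_extend]
  refine poly_dvd_of_forall_zero (isForm_extend hp) (poly_extend_irreducible hp hm) he hpe
    fun x hx => ?_
  rw [eval_map, ← aeval_def]
  exact hf x hx

theorem poly_binary (p : QuadraticForm F (Fin 2 → F)) :
    poly p = C (p.toMatrix' 0 0) * X 0 * X 0 + C (p.toMatrix' 0 1) * X 0 * X 1 +
      (C (p.toMatrix' 1 0) * X 1 * X 0 + C (p.toMatrix' 1 1) * X 1 * X 1) := by
  simp [poly, Fin.sum_univ_two]

theorem aeval_poly_binary {K : Type*} [Field K] [Algebra F K] [Invertible (2 : K)]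
    {p : QuadraticForm F (Fin 2 → F)} {θ : K} (hpθ : extend p K ![θ, 1] = 0) :
    aeval (![Polynomial.C θ * Polynomial.X, Polynomial.X] : Fin 2 → Polynomial K)
      (poly p) = 0 := by
  have h : algebraMap F K (p.toMatrix' 0 0) * θ * θ + algebraMap F K (p.toMatrix' 0 1) * θ +
      (algebraMap F K (p.toMatrix' 1 0) * θ + algebraMap F K (p.toMatrix' 1 1)) = 0 := by
    rw [← aeval_poly, poly_binary] at hpθ
    simpa using hpθ
  have := congrArg Polynomial.C h
  simp only [map_add, map_mul, map_zero] at this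
  rw [poly_binary]
  simp [Polynomial.algebraMap_apply]
  linear_combination (Polynomial.X ^ 2) * this

/-- Over `K` the quadric splits into lines, and the generic point `(θ T, T)` of one of them is
enough. Modulo `p`, `f` is `A(X₁) + X₀ B(X₁)`; its value `A(T) + θ T B(T)` vanishes only for `A = B
= 0`, as `1, θ` are independent over `F`. -/
theorem poly_dvd_of_binary {K : Type*} [Field K] [Algebra F K] [Invertible (2 : K)]
    {p : QuadraticForm F (Fin 2 → F)} (hp : p (Pi.single 0 1) ≠ 0) {θ : K}
    (hθ : ∀ a b : F, algebraMap F K a + algebraMap F K b * θ = 0 → a = 0 ∧ b = 0)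
    (hpθ : extend p K ![θ, 1] = 0) {f : MvPolynomial (Fin 2) F}
    (hf : aeval (![Polynomial.C θ * Polynomial.X, Polynomial.X] : Fin 2 → Polynomial K) f = 0) :
    poly p ∣ f := by
  let ι : Polynomial F →ₐ[F] MvPolynomial (Fin 2) F := Polynomial.aeval (X 1)
  have hpz := aeval_poly_binary hpθ
  have hpoly := poly_binary p
  generalize p.toMatrix' 0 0 = a, p.toMatrix' 0 1 = b, p.toMatrix' 1 0 = b', p.toMatrix' 1 1 = c
    at hpoly
  have ha : a ≠ 0 := by
    rw [← eval_poly, hpoly] at hp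
    simpa using hp
  have key : ∀ f : MvPolynomial (Fin 2) F, ∃ A B : Polynomial F,
      poly p ∣ f - (ι A + X 0 * ι B) := by
    intro f
    induction f using MvPolynomial.induction_on with
    | C t => exact ⟨Polynomial.C t, 0, by simp [ι, algebraMap_eq]⟩
    | add f f' h h' =>
      obtain ⟨A, B, h⟩ := h
      obtain ⟨A', B', h'⟩ := h'
      refine ⟨A + A', B + B', ?_⟩
      convert dvd_add h h' using 1
      simp only [map_add]
      ring
    | mul_X f i h =>
      obtain ⟨A, B, h⟩ := h
      fin_cases i
      -- Reduction by `X₀² ≡ -a⁻¹ ((b + b') X₀ X₁ + c X₁²)` modulo `p`.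
      · refine ⟨-(Polynomial.C (a⁻¹ * c) * Polynomial.X ^ 2 * B),
          A - Polynomial.C (a⁻¹ * (b + b')) * Polynomial.X * B, ?_⟩
        convert dvd_add (h.mul_right (X 0)) (dvd_mul_right (poly p) (C a⁻¹ * ι B)) using 1
        have hC : (C a⁻¹ : MvPolynomial (Fin 2) F) * C a = 1 := by
          rw [← C_mul, inv_mul_cancel₀ ha, C_1]
        simp [ι, algebraMap_eq, hpoly]
        linear_combination (-X 0 ^ 2 * Polynomial.aeval (X 1) B) * hC
      · refine ⟨A * Polynomial.X, B * Polynomial.X, ?_⟩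
        convert h.mul_right (X 1) using 1
        simp [ι]
        ring
  obtain ⟨A, B, hAB⟩ := key f
  obtain ⟨g, hg⟩ := hAB
  have hι : ∀ A : Polynomial F, aeval (![Polynomial.C θ * Polynomial.X, Polynomial.X] :
      Fin 2 → Polynomial K) (ι A) = A.map (algebraMap F K) := fun A => by
    simp only [ι]
    rw [← Polynomial.aeval_algHom_apply]
    simp [Polynomial.aeval_X_left_eq_map]
  have h1 := congrArg (aeval (![Polynomial.C θ * Polynomial.X, Polynomial.X] :
    Fin 2 → Polynomial K)) hg
  rw [map_sub, map_add, map_mul, map_mul, hpz, hf, hι, hι, zero_mul, zero_sub, neg_eq_zero,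
    aeval_X] at h1
  have hA0 : A = 0 ∧ B = 0 := by
    have h2 : ∀ k, A.coeff (k + 1) = 0 ∧ B.coeff k = 0 := fun k => by
      have := congrArg (fun z => Polynomial.coeff z (k + 1)) h1
      refine hθ _ _ ?_
      simp [mul_assoc, Polynomial.coeff_X_mul] at this
      linear_combination this
    have h3 : A.coeff 0 = 0 := by
      have := congrArg (fun z => Polynomial.coeff z 0) h1
      simpa [mul_assoc] using this
    constructor
    · ext k
      cases k with
      | zero => simpa using h3
      | succ k => simpa using (h2 k).1
    · ext k
      simpa using (h2 k).2
  refine ⟨g, ?_⟩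
  rw [← hg, hA0.1, hA0.2]
  simp

end Density

/-! ### From the function field to a quadratic extension -/

section FunctionField

open MvPolynomial

variable {F : Type*} [Field F] [Invertible (2 : F)] {m : ℕ} {p : QuadraticForm F (Fin m → F)}

theorem exists_algHom_ne_zero {E : Type*} [Field E] [Algebra F E]
    (h : ∀ f : MvPolynomial (Fin m) F,
      (∀ x : Fin m → E, aeval x (poly p) = 0 → aeval x f = 0) → poly p ∣ f)
    (f : CoordRing p) (hf : f ≠ 0) : ∃ φ : CoordRing p →ₐ[F] E, φ f ≠ 0 := by
  obtain ⟨f, rfl⟩ := Ideal.Quotient.mk_surjective f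
  by_contra! hcon
  refine hf (Ideal.Quotient.eq_zero_iff_mem.2 (Ideal.mem_span_singleton.2 (h f fun x hx => ?_)))
  have hI : ∀ g ∈ Ideal.span {poly p}, aeval x g = 0 := fun g hg => by
    obtain ⟨g', rfl⟩ := Ideal.mem_span_singleton.1 hg
    rw [map_mul, hx, zero_mul]
  exact hcon (Ideal.Quotient.liftₐ _ (aeval x) hI)

open Polynomial in
-- The detour through `K(X)` provides an infinite field and a parameter for generic points, even
-- when `K` is finite.
theorem Metabolic.of_forall_dvd [IsDomain (CoordRing p)] {K : Type*} [Field K] [Algebra F K]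
    (hd : ∀ f : MvPolynomial (Fin m) F,
      (∀ x : Fin m → FractionRing K[X], aeval x (poly p) = 0 → aeval x f = 0) → poly p ∣ f)
    {n : ℕ} {a : Fin n → F} (h : Metabolic a (FractionRing (CoordRing p))) : Metabolic a K :=
  Metabolic.of_rational_function (L := FractionRing K[X])
    (h.specialize (R := CoordRing p) (exists_algHom_ne_zero hd))

theorem extend_algebraMap_algebraMap {K E : Type*} [Field K] [Algebra F K] [Field E] [Algebra F E]
    [Algebra K E] [IsScalarTower F K E] [Invertible (2 : K)] [Invertible (2 : E)] (x : Fin m → K) :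
    extend p E (fun i => algebraMap K E (x i)) = algebraMap K E (extend p K x) := by
  rw [← aeval_poly, ← aeval_poly]
  exact MvPolynomial.aeval_algebraMap_apply (B := E) x (poly p)

theorem Metabolic.of_three_le [IsDomain (CoordRing p)] (hp : IsForm p) (hm : 3 ≤ m) {K : Type*}
    [Field K] [Algebra F K] [Invertible (2 : K)] {e : Fin m → K} (he : e ≠ 0)
    (hpe : extend p K e = 0) {n : ℕ} {a : Fin n → F}
    (h : Metabolic a (FractionRing (CoordRing p))) : Metabolic a K := by
  let E := FractionRing (Polynomial K)
  let _ : Invertible (2 : E) := (Invertible.map (algebraMap F E) 2).copy 2 (map_ofNat _ _).symm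
  have : Infinite E := Infinite.of_injective (algebraMap (Polynomial K) E)
    (IsFractionRing.injective (Polynomial K) E)
  refine h.of_forall_dvd fun f hf => poly_dvd_of_three_le (E := E) hp hm
    (e := fun i => algebraMap K E (e i)) (fun h0 => he ?_) ?_ fun x hx => hf x ?_
  · ext i
    exact (algebraMap K E).injective ((congrFun h0 i).trans (map_zero _).symm)
  · rw [extend_algebraMap_algebraMap, hpe, map_zero]
  · rw [aeval_poly, hx]

theorem Metabolic.of_binary {p : QuadraticForm F (Fin 2 → F)} [IsDomain (CoordRing p)]
    (hp : p (Pi.single 0 1) ≠ 0) {K : Type*} [Field K] [Algebra F K] [Invertible (2 : K)] {θ : K}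
    (hθ : ∀ a b : F, algebraMap F K a + algebraMap F K b * θ = 0 → a = 0 ∧ b = 0)
    (hpθ : extend p K ![θ, 1] = 0) {n : ℕ} {a : Fin n → F}
    (h : Metabolic a (FractionRing (CoordRing p))) : Metabolic a K := by
  let E := FractionRing (Polynomial K)
  refine h.of_forall_dvd fun f hf => poly_dvd_of_binary hp hθ hpθ ?_
  have hinj : Function.Injective (algebraMap (Polynomial K) E) :=
    IsFractionRing.injective (Polynomial K) E
  have hval : ∀ g : MvPolynomial (Fin 2) F,
      aeval (fun i => algebraMap (Polynomial K) E
        ((![Polynomial.C θ * Polynomial.X, Polynomial.X] : Fin 2 → Polynomial K) i)) g =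
      algebraMap (Polynomial K) E
        (aeval (![Polynomial.C θ * Polynomial.X, Polynomial.X] : Fin 2 → Polynomial K) g) :=
    fun g => MvPolynomial.aeval_algebraMap_apply (B := E) _ g
  apply hinj
  rw [← hval, map_zero]
  refine hf _ ?_
  rw [hval, aeval_poly_binary hpθ, map_zero]

/-- In coordinates `z = κ x + ω y` the coefficient of `κ²` is `p x = 0`, so `p` is `ω` times a
linear form. -/
theorem exceptional_of_isotropic {p : QuadraticForm F (Fin 2 → F)} (hp : IsForm p)
    {x : Fin 2 → F} (hx : x ≠ 0) (hpx : p x = 0) : p.Equivalent (hyperbolicPlane F) := by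
  obtain ⟨y, hy⟩ : ∃ y : Fin 2 → F, x 0 * y 1 - x 1 * y 0 = 1 := by
    by_cases h : x 0 = 0
    · have h1 : x 1 ≠ 0 := fun h1 => hx (by ext i; fin_cases i <;> assumption)
      exact ⟨![-(x 1)⁻¹, 0], by simp [h1]⟩
    · exact ⟨![0, (x 0)⁻¹], by simp [h]⟩
  let ω : (Fin 2 → F) →ₗ[F] F := x 0 • LinearMap.proj 1 - x 1 • LinearMap.proj 0
  let κ : (Fin 2 → F) →ₗ[F] F := y 1 • LinearMap.proj 0 - y 0 • LinearMap.proj 1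
  have hω : ∀ z, ω z = x 0 * z 1 - x 1 * z 0 := fun z => by simp [ω]
  have hκ : ∀ z, κ z = y 1 * z 0 - y 0 * z 1 := fun z => by simp [κ]
  refine (exceptional_of_eq_mul p hp ω (p y • ω + QuadraticMap.polar p x y • κ) fun z => ?_).resolve_left
    (by norm_num)
  have hz : z = κ z • x + ω z • y := by
    ext i
    fin_cases i
    · simp [hω, hκ]
      linear_combination (-z 0) * hy
    · simp [hω, hκ]
      linear_combination (-z 1) * hy
  conv_lhs => rw [hz]
  rw [QuadraticMap.map_add p, QuadraticMap.map_smul, QuadraticMap.map_smul, hpx,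
    QuadraticMap.polar_smul_left, QuadraticMap.polar_smul_right]
  simp
  ring

theorem exists_isSkewRoot (hp : IsForm p) (hexc : ¬ (m = 1 ∨ p.Equivalent (hyperbolicPlane F)))
    [IsDomain (CoordRing p)] {n : ℕ} (hn : 0 < n) {a : Fin n → F} (ha : (diag a).Anisotropic)
    (h : Metabolic a (FractionRing (CoordRing p))) :
    ∃ d : F, d ≠ 0 ∧ ∃ J, IsSkewRoot (diag a) d J := by
  have hm0 : 0 < m := by simpa using hp.pos
  have hm1 : m ≠ 1 := fun h => hexc (.inl h)
  have hm : 2 ≤ m := by omega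
  by_cases hpa : p.Anisotropic
  swap
  · exfalso
    simp only [QuadraticMap.Anisotropic, not_forall] at hpa
    obtain ⟨x, hpx, hx⟩ := hpa
    rcases hm.eq_or_lt with rfl | hm
    · exact hexc (.inr (exceptional_of_isotropic hp hx hpx))
    · refine (h.of_three_le (K := F) hp hm (e := x) hx ?_).not_anisotropic hn ha
      have := extend_algebraMap (E := F) p x
      simpa [hpx] using this
  obtain ⟨m, rfl⟩ := Nat.exists_eq_add_of_le' hm
  let e₀ : Fin (m + 2) → F := Pi.single 0 1
  let e₁ : Fin (m + 2) → F := Pi.single 1 1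
  let α := p e₀
  let β := QuadraticMap.polar p e₀ e₁
  let γ := p e₁
  have hval : ∀ s t : F, p (s • e₀ + t • e₁) = α * s * s + β * s * t + γ * t * t := fun s t => by
    rw [QuadraticMap.map_add p, QuadraticMap.map_smul, QuadraticMap.map_smul,
      QuadraticMap.polar_smul_left, QuadraticMap.polar_smul_right]
    simp only [smul_eq_mul, α, β, γ]
    ring
  have hα : α ≠ 0 := fun h => by
    have := congrFun (hpa e₀ h) 0
    simp [e₀] at this
  have h2 : (2 : F) ≠ 0 := Invertible.ne_zero 2
  -- Discriminant of `p` on the plane of `e₀, e₁`. A square root `r` in `F` would give the zero `(r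
  -- - β) e₀ + 2α e₁` of the anisotropic form `p`.
  let δ := β * β - 4 * α * γ
  have hδ : Fact (∀ r : F, r ^ 2 ≠ δ + 0 * r) := ⟨fun r hr => by
    have h1 := hval (r - β) (2 * α)
    have h3 : p ((r - β) • e₀ + (2 * α) • e₁) = 0 := by
      rw [h1]
      simp only [δ] at hr
      linear_combination α * hr
    have h4 := congrFun (hpa _ h3) 1
    simp [e₀, e₁, h2, hα] at h4⟩
  refine ⟨δ, fun h0 => hδ.out 0 (by rw [h0]; ring), ?_⟩
  let K := QuadraticAlgebra F δ 0
  let _ : Invertible (2 : K) := (Invertible.map (algebraMap F K) 2).copy 2 (map_ofNat _ _).symm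
  refine Metabolic.exists_isSkewRoot (d := δ) ha (?_ : Metabolic a K)
  -- The root `(-β + √δ) / (2α)` of `α T² + β T + γ`; hence `θ e₀ + e₁` is a zero of `p` over `K`.
  let θ : K := ⟨-β / (2 * α), 1 / (2 * α)⟩
  have hθ : ∀ a b : F, algebraMap F K a + algebraMap F K b * θ = 0 → a = 0 ∧ b = 0 := by
    intro a b hab
    have h1 := congrArg QuadraticAlgebra.im hab
    have h3 := congrArg QuadraticAlgebra.re hab
    have hb : b = 0 := by simpa [K, θ, h2, hα] using h1
    rw [hb] at h3
    exact ⟨by simpa [K, θ] using h3, hb⟩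
  have hroot : algebraMap F K α * θ * θ + algebraMap F K β * θ + algebraMap F K γ = 0 := by
    ext
    · simp [K, θ, δ]
      field_simp
      ring
    · simp [K, θ]
      field_simp
      ring
  let e : Fin (m + 2) → K := θ • (fun i => algebraMap F K (e₀ i)) + fun i => algebraMap F K (e₁ i)
  have he : extend p K e = 0 := by
    have hpol : QuadraticMap.polar (extend p K) (fun i => algebraMap F K (e₀ i))
        (fun i => algebraMap F K (e₁ i)) = algebraMap F K β := by
      have h1 : ((fun i => algebraMap F K (e₀ i)) + fun i => algebraMap F K (e₁ i)) =
          fun i => algebraMap F K ((e₀ + e₁) i) := by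
        ext1 i
        simp
      simp only [QuadraticMap.polar, h1, extend_algebraMap, β, map_sub]
    simp only [e]
    rw [QuadraticMap.map_add (extend p K), QuadraticMap.map_smul, QuadraticMap.polar_smul_left,
      hpol, extend_algebraMap, extend_algebraMap]
    simp only [smul_eq_mul]
    linear_combination hroot
  rcases Nat.eq_zero_or_pos m with rfl | hm
  · refine h.of_binary (K := K) (θ := θ) hα hθ ?_
    convert he using 2
    ext1 i
    fin_cases i <;> simp [e, e₀, e₁]
  · refine h.of_three_le (K := K) hp (by omega) (e := e) (fun h0 => ?_) he
    have := congrFun h0 1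
    simp [e, e₀, e₁] at this

end FunctionField

/-! ### Pfister multiples and the two implications -/

section Main

theorem isPfister_one {F : Type u} [Field F] [Invertible (2 : F)] (a : Fˣ) :
    IsPfister 1 (diag ![(1 : F), (a : F)]) := by
  refine ⟨a, Fin 1 → F, inferInstance, inferInstance, diag ![1], .refl _, ?_⟩
  have h : (diag ![(1 : F), (a : F)]).Equivalent
      (QuadraticForm.tmul (diag ![(1 : F), (a : F)]) (QuadraticMap.sq (R := F))) :=
    ⟨(QuadraticForm.tensorRId _).symm⟩
  refine h.trans (equivalent_of_basis
    ((Pi.basisFun F (Fin 2)).tensorProduct (Module.Basis.singleton (Fin 1) F))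
    ((Pi.basisFun F (Fin 2)).tensorProduct (Pi.basisFun F (Fin 1))) ?_)
  rintro ⟨i, k⟩ ⟨j, l⟩
  rw [QuadraticForm.associated_tmul, QuadraticForm.associated_tmul]
  simp [associated_diag, Subsingleton.elim k 0, Subsingleton.elim l 0]

variable {F : Type u} [Field F] [Invertible (2 : F)]

/-- Only the outermost factor `⟨1, a⟩` matters: its skew root acts on the first tensor factor. -/
theorem IsPfister.exists_isSkewRoot {n : ℕ} {W : Type u} [AddCommGroup W] [Module F W]
    {π : QuadraticForm F W} (hπ : IsPfister (n + 1) π) :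
    ∃ a : Fˣ, ∃ J, IsSkewRoot π (-(a : F)) J := by
  obtain ⟨a, W', _, _, σ, -, h⟩ := hπ
  exact ⟨a, ((isSkewRoot_diag (a : F)).tmul σ).of_equivalent h⟩

/-- `-a` becomes a square in the function field of `⟨1, a⟩`. -/
theorem exists_sq_functionField (a : Fˣ) (hp : IsForm (diag ![(1 : F), (a : F)])) :
    ∃ s : (functionField (diag ![(1 : F), (a : F)]) hp).carrier,
      s * s = algebraMap F _ (-(a : F)) := by
  have hpoly : poly (diag ![(1 : F), (a : F)]) =
      MvPolynomial.X 0 ^ 2 + MvPolynomial.C (a : F) * MvPolynomial.X 1 ^ 2 := by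
    rw [poly_binary]
    simp [QuadraticForm.toMatrix', LinearMap.toMatrix₂'_apply, associated_diag]
    ring
  by_cases h : 2 = 1 ∨ (diag ![(1 : F), (a : F)]).Equivalent (hyperbolicPlane F)
  · unfold functionField
    rw [dif_pos h]
    -- Here the function field is `F`, and the image of the isotropic vector `(1, 1)` is a zero of
    -- `X₀² + a X₁²` with `X₁ ≠ 0`.
    obtain ⟨e⟩ := (h.resolve_left (by norm_num)).symm
    have h1 := e.map_app ![1, 1]
    have h2 : e ![1, 1] ≠ 0 := fun h0 => by
      have := congrFun ((map_eq_zero_iff e.toLinearEquiv e.toLinearEquiv.injective).1 h0) 0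
      simp at this
    generalize e ![1, 1] = x at h1 h2
    simp [diag, hyperbolicPlane, QuadraticMap.weightedSumSquares_apply] at h1
    have h3 : x 1 ≠ 0 := fun h3 => h2 <| by
      rw [h3] at h1
      ext i
      fin_cases i
      · simpa using h1
      · exact h3
    refine ⟨x 0 / x 1, ?_⟩
    change x 0 / x 1 * (x 0 / x 1) = -(a : F)
    field_simp
    linear_combination h1
  · unfold functionField
    rw [dif_neg h]
    have hdom := coordRing_isDomain _ hp h
    let R := CoordRing (diag ![(1 : F), (a : F)])
    let x : Fin 2 → R := fun i => Ideal.Quotient.mk _ (MvPolynomial.X i)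
    have hx : x 0 ^ 2 + algebraMap F R a * x 1 ^ 2 = 0 := by
      have : (Ideal.Quotient.mk (Ideal.span {poly (diag ![(1 : F), (a : F)])}))
          (MvPolynomial.X 0 ^ 2 + MvPolynomial.C (a : F) * MvPolynomial.X 1 ^ 2) = 0 :=
        Ideal.Quotient.eq_zero_iff_mem.2
          (Ideal.mem_span_singleton.2 (hpoly ▸ dvd_refl _))
      rw [map_add, map_mul, map_pow, map_pow] at this
      exact this
    -- By degree, the quadratic equation cannot divide `X₁`; so `X₀ / X₁` is a square root of `-a`.
    have hx1 : x 1 ≠ 0 := by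
      intro h0
      obtain ⟨g, hg⟩ := Ideal.mem_span_singleton.1 (Ideal.Quotient.eq_zero_iff_mem.1 h0)
      have hirr := poly_irreducible _ hp h
      have hg0 : g ≠ 0 := by
        rintro rfl
        rw [mul_zero] at hg
        exact MvPolynomial.X_ne_zero _ hg
      have := MvPolynomial.totalDegree_mul_of_isDomain hirr.ne_zero hg0
      rw [← hg, MvPolynomial.totalDegree_X, (poly_isHomogeneous _).totalDegree hirr.ne_zero] at this
      omega
    let L := FractionRing R
    have hinj : Function.Injective (algebraMap R L) := IsFractionRing.injective R L
    refine ⟨(algebraMap R L (x 0) / algebraMap R L (x 1) : L), ?_⟩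
    change algebraMap R L (x 0) / algebraMap R L (x 1) * (algebraMap R L (x 0) / algebraMap R L (x 1))
      = algebraMap F L (-(a : F))
    have h1 : algebraMap R L (x 1) ≠ 0 := fun h0 => hx1 (hinj (by rw [h0, map_zero]))
    have h2 := congrArg (algebraMap R L) hx
    rw [map_add, map_mul, map_pow, map_pow, map_zero, ← IsScalarTower.algebraMap_apply] at h2
    rw [map_neg, div_mul_div_comm, div_eq_iff (mul_ne_zero h1 h1)]
    linear_combination h2

theorem exists_isSkewRoot_of_isHyperbolicOver {V : Type v} [AddCommGroup V] [Module F V]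
    {q : QuadraticForm F V} (hq : IsForm q) (hqa : q.Anisotropic) {m : ℕ}
    {p : QuadraticForm F (Fin m → F)} (hp : IsForm p)
    (h : IsHyperbolicOver q (functionField p hp)) : ∃ d : F, d ≠ 0 ∧ ∃ J, IsSkewRoot q d J := by
  have := hq.finite
  obtain ⟨a, ha⟩ := QuadraticForm.equivalent_weightedSumSquares q
  have haa : (diag a).Anisotropic := by
    obtain ⟨e⟩ := ha
    intro x hx
    have := hqa (e.symm x) ((e.symm.map_app x).trans hx)
    exact (map_eq_zero_iff e.symm.toLinearEquiv e.symm.toLinearEquiv.injective).1 this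
  have hmet := metabolic_of_isHyperbolic_baseChange ha h
  by_cases hexc : m = 1 ∨ p.Equivalent (hyperbolicPlane F)
  · have h1 : functionField p hp = { carrier := F } := dif_pos hexc
    rw [h1] at hmet
    exact absurd haa (Metabolic.not_anisotropic hmet hq.pos)
  · have := coordRing_isDomain p hp hexc
    have h1 : functionField p hp = { carrier := FractionRing (CoordRing p) } := dif_neg hexc
    rw [h1] at hmet
    obtain ⟨d, hd, J, hJ⟩ := exists_isSkewRoot hp hexc hq.pos haa hmet
    exact ⟨d, hd, hJ.of_equivalent ha⟩

end Main

end QuadForm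

theorem mainTheorem10 {F : Type u} [Field F] [Invertible (2 : F)]
    {V : Type v} [AddCommGroup V] [Module F V] (q : QuadraticForm F V)
    (hq : QuadForm.IsForm q) (hqa : q.Anisotropic) :
    (∃ (m : ℕ) (p : QuadraticForm F (Fin m → F)) (hp : QuadForm.IsForm p),
        QuadForm.IsHyperbolicOver q (QuadForm.functionField p hp)) ↔
      ∃ (n : ℕ) (_ : 1 ≤ n) (W : Type u) (_ : AddCommGroup W) (_ : Module F W)
        (π : QuadraticForm F W) (l : ℕ) (r : QuadraticForm F (Fin l → F)),
        QuadForm.IsPfister n π ∧ QuadForm.IsForm r ∧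
          q.Equivalent (QuadraticForm.tmul π r) := by
  have := hq.finite
  constructor
  · rintro ⟨m, p, hp, h⟩
    obtain ⟨d, hd, J, hJ⟩ := QuadForm.exists_isSkewRoot_of_isHyperbolicOver hq hqa hp h
    obtain ⟨l, c, hc, hqc⟩ := hJ.equivalent_tmul hq.pos hqa hd
    exact ⟨1, le_rfl, _, _, _, _, l, _, QuadForm.isPfister_one (Units.mk0 (-d) (neg_ne_zero.2 hd)),
      hc, hqc⟩
  · rintro ⟨n, hn, W, _, _, π, l, r, hπ, -, h⟩
    obtain ⟨n, rfl⟩ := Nat.exists_eq_add_of_le' hn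
    obtain ⟨a, J, hJ⟩ := hπ.exists_isSkewRoot
    obtain ⟨J', hJ'⟩ := (hJ.tmul r).of_equivalent h
    have hp : QuadForm.IsForm (QuadForm.diag ![(1 : F), (a : F)]) :=
      QuadForm.isForm_diag (by norm_num) _ fun i => by fin_cases i <;> simp
    obtain ⟨s, hs⟩ := QuadForm.exists_sq_functionField a hp
    -- The witness is `p = ⟨1, a⟩`, for any one binary factor `⟨1, a⟩` of the Pfister form.
    exact ⟨2, _, hp, hJ'.isHyperbolic_baseChange hq.pos hqa (by simp) _ s hs⟩
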